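/- Let $\mathrm{Diff}^\infty(\mathbb R/\mathbb Z)$ be the group of orientation preserving $C^\infty$ diffeomorphisms of the circle $\mathbb R/\mathbb Z$, with the $C^\infty$ topology, and let $d$ be a metric on it inducing this topology. Let $F_1,F_2,F_3\in \mathrm{Diff}^\infty(\mathbb R/\mathbb Z)$ be such that: (i) $F_1$ has exactly two fixed points, a repelling one at $1/2$ and an attracting one at $1=0$, and $F_1$ is affine on $(1/10,9/10)$ and on the complement of $(1/100,99/100)$; (ii) $F_2$ is the identity outside $(1/4,3/4)$ and $F_2(x)=x+1/100$ for $x\in(2/5,3/5)$; (iii) $F_3$ is an irrational rotation. Then there exist a sequence of real numbers $\epsilon'_n>0$ and a sequence of positive integers $k'_n$ such that the following holds. If $f_n,g_n\in \mathrm{Diff}^\infty(\mathbb R/\mathbb Z)$ are supported on $(1/7,6/7)$ (that is, they are the identity outside this arc) and satisfy $d(f_n,\mathrm{id})<\epsilon'_n$ and $d(g_n,\mathrm{id})<\epsilon'_n$ for every $n$, then there exist $F_4,F_5\in \mathrm{Diff}^\infty(\mathbb R/\mathbb Z)$ such that, with $S=\{F_1,F_2,F_3,F_4,F_5\}$ and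 $G$ the group generated by $S$, for every $n$ the commutator $[f_n,g_n]=f_ng_nf_n^{-1}g_n^{-1}$ belongs to $G$ and satisfies $d_S([f_n,g_n],\mathrm{id})\le k'_n$. Here $d_S(g_1,g_2)$ is the word metric: the infimum of the integers $k\ge 0$ such that $g_2=s_1^{\pm1}\cdots s_k^{\pm1}g_1$ for some $s_1,\dots,s_k\in S$. -/

import Mathlib

open scoped ContDiff

/-- `F : ℝ → ℝ` is a lift of the circle map `f : ℝ/ℤ → ℝ/ℤ` exhibiting `f` as an orientation
preserving local `C^∞` diffeomorphism of degree one. -/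
structure IsSmoothLift (F : ℝ → ℝ) (f : UnitAddCircle → UnitAddCircle) : Prop where
  smooth : ContDiff ℝ ∞ F
  deriv_pos : ∀ x, 0 < deriv F x
  map_add_one : ∀ x, F (x + 1) = F x + 1
  map_coe : ∀ x : ℝ, f (x : UnitAddCircle) = ((F x : ℝ) : UnitAddCircle)

theorem IsSmoothLift.comp {F G : ℝ → ℝ} {f g : UnitAddCircle → UnitAddCircle}
    (hF : IsSmoothLift F f) (hG : IsSmoothLift G g) : IsSmoothLift (F ∘ G) (f ∘ g) where
  smooth := hF.smooth.comp hG.smooth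
  deriv_pos x := by
    rw [deriv_comp x (hF.smooth.differentiable (by simp) _) (hG.smooth.differentiable (by simp) _)]
    exact mul_pos (hF.deriv_pos _) (hG.deriv_pos _)
  map_add_one x := by simp [hG.map_add_one, hF.map_add_one]
  map_coe x := by simp [hG.map_coe, hF.map_coe]

theorem IsSmoothLift.map_add_natCast {F : ℝ → ℝ} {f : UnitAddCircle → UnitAddCircle}
    (hF : IsSmoothLift F f) (x : ℝ) (n : ℕ) : F (x + n) = F x + n := by
  induction n with
  | zero => simp
  | succ n ih => push_cast; rw [← add_assoc, hF.map_add_one, ih, add_assoc]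

theorem IsSmoothLift.surjective {F : ℝ → ℝ} {f : UnitAddCircle → UnitAddCircle}
    (hF : IsSmoothLift F f) : Function.Surjective F := by
  intro y
  obtain ⟨n, hn⟩ := exists_nat_ge (y - F 0)
  obtain ⟨m, hm⟩ := exists_nat_ge (F 0 - y)
  have h1 := hF.map_add_natCast 0 n
  have h2 := hF.map_add_natCast (-(m : ℝ)) m
  rw [zero_add] at h1
  rw [neg_add_cancel] at h2
  have := intermediate_value_univ (-(m : ℝ)) (n : ℝ) hF.smooth.continuous
  exact this ⟨by linarith, by linarith⟩

theorem IsSmoothLift.exists_inv {F : ℝ → ℝ} {f : Equiv.Perm UnitAddCircle}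
    (hF : IsSmoothLift F f) : ∃ G, IsSmoothLift G (f⁻¹ : Equiv.Perm UnitAddCircle) := by
  have hmono : StrictMono F := strictMono_of_deriv_pos hF.deriv_pos
  let e : ℝ ≃ₜ ℝ := (hmono.orderIsoOfSurjective F hF.surjective).toHomeomorph
  have hd : ∀ x, HasDerivAt e (deriv F x) x :=
    fun x => (hF.smooth.differentiable (by simp) x).hasDerivAt
  have he : ∀ x, F (e.symm x) = x := fun x => e.apply_symm_apply x
  refine ⟨e.symm, ?_, ?_, ?_, ?_⟩
  · exact e.contDiff_symm_deriv (fun x => (hF.deriv_pos x).ne') hd hF.smooth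
  · intro x
    have := HasDerivAt.of_local_left_inverse e.symm.continuous.continuousAt (hd (e.symm x))
      (hF.deriv_pos _).ne' (Filter.Eventually.of_forall he)
    rw [this.deriv]
    exact inv_pos.2 (hF.deriv_pos _)
  · intro x
    apply hmono.injective
    rw [hF.map_add_one, he, he]
  · intro x
    rw [Equiv.Perm.inv_eq_iff_eq, hF.map_coe, he]

/-- The group of orientation preserving `C^∞` diffeomorphisms of the circle `ℝ/ℤ`, with
composition as multiplication, as a subgroup of the permutations of `ℝ/ℤ`. -/
def circleDiffSubgroup : Subgroup (Equiv.Perm UnitAddCircle) where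
  carrier := {f | ∃ F : ℝ → ℝ, IsSmoothLift F f}
  mul_mem' := by
    rintro f g ⟨F, hF⟩ ⟨G, hG⟩
    exact ⟨F ∘ G, hF.comp hG⟩
  one_mem' := ⟨id, contDiff_id, by simp, by simp, by simp⟩
  inv_mem' := by
    rintro f ⟨F, hF⟩
    exact hF.exists_inv

/-- The group of orientation preserving `C^∞` diffeomorphisms of the circle `ℝ/ℤ`. -/
abbrev CircleDiff : Type := circleDiffSubgroup

/-- A lift of `f` to the real line, well defined up to an integer constant. -/
noncomputable def CircleDiff.lift (f : CircleDiff) : ℝ → ℝ := f.2.choose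

theorem CircleDiff.isSmoothLift_lift (f : CircleDiff) :
    IsSmoothLift f.lift (f : Equiv.Perm UnitAddCircle) := f.2.choose_spec

/-- For `r ≥ 1` the `r`-th derivative of a lift does not depend on the lift. -/
theorem IsSmoothLift.iteratedDeriv_eq {F G : ℝ → ℝ} {f : UnitAddCircle → UnitAddCircle}
    (hF : IsSmoothLift F f) (hG : IsSmoothLift G f) (r : ℕ) :
    iteratedDeriv (r + 1) F = iteratedDeriv (r + 1) G := by
  have hint : ∀ x, ∃ n : ℤ, (n : ℝ) = F x - G x := by
    intro x
    have h := (hF.map_coe x).symm.trans (hG.map_coe x)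
    rw [← sub_eq_zero, ← AddCircle.coe_sub, AddCircle.coe_eq_zero_iff] at h
    obtain ⟨n, hn⟩ := h
    exact ⟨n, by simpa using hn⟩
  choose n hn using hint
  have hc : Continuous n := by
    apply Int.isClosedEmbedding_coe_real.isEmbedding.continuous_iff.2
    exact (hF.smooth.continuous.sub hG.smooth.continuous).congr fun x => (hn x).symm
  have hFG : F = fun x => G x + n 0 := by
    funext x
    have := PreconnectedSpace.constant inferInstance hc (x := x) (y := 0)
    rw [← this, hn]
    ring
  rw [iteratedDeriv_succ', iteratedDeriv_succ', hFG]
  simp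

/-- The `C^∞` topology: uniform convergence of the maps on the circle, and of the derivatives
of all orders `r + 1 ≥ 1`. -/
noncomputable abbrev CircleDiff.smoothTopology : TopologicalSpace CircleDiff :=
  TopologicalSpace.induced
      (fun f : CircleDiff => UniformFun.ofFun (f : Equiv.Perm UnitAddCircle)) inferInstance ⊓
    ⨅ r : ℕ, TopologicalSpace.induced
      (fun f : CircleDiff => UniformFun.ofFun (iteratedDeriv (r + 1) f.lift)) inferInstance

/-- `f` is supported on the arc `(a, b)` of `ℝ/ℤ`: it is the identity outside that arc. -/
def CircleDiff.SupportedOn (f : CircleDiff) (a b : ℝ) : Prop :=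
  ∀ x : UnitAddCircle, x ∉ ((↑) : ℝ → UnitAddCircle) '' Set.Ioo a b →
    (f : Equiv.Perm UnitAddCircle) x = x

/-- The fixed points of `f` are exactly `1/2` and `0 = 1`; `f` is affine on the arc
`(1/10, 9/10)` and on the complementary arc of `(1/100, 99/100)`, the fixed point `1/2` being
repelling (slope `a > 1`) and the fixed point `0` being attracting (slope `b < 1`). -/
structure CircleDiff.IsRepellerAttractor (f : CircleDiff) : Prop where
  fixed_iff : ∀ x : UnitAddCircle, (f : Equiv.Perm UnitAddCircle) x = x ↔
    x = ((1 / 2 : ℝ) : UnitAddCircle) ∨ x = ((1 : ℝ) : UnitAddCircle)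
  repelling : ∃ a : ℝ, 1 < a ∧ ∀ x ∈ Set.Ioo (1 / 10 : ℝ) (9 / 10),
    (f : Equiv.Perm UnitAddCircle) (x : UnitAddCircle) =
      ((1 / 2 + a * (x - 1 / 2) : ℝ) : UnitAddCircle)
  attracting : ∃ b : ℝ, b < 1 ∧ ∀ x ∈ Set.Icc (-1 / 100 : ℝ) (1 / 100),
    (f : Equiv.Perm UnitAddCircle) (x : UnitAddCircle) = ((b * x : ℝ) : UnitAddCircle)

/-- `f` is the identity outside `(1/4, 3/4)`, and `f(x) = x + 1/100` on `(2/5, 3/5)`. -/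
structure CircleDiff.IsBump (f : CircleDiff) : Prop where
  supported : f.SupportedOn (1 / 4) (3 / 4)
  translation : ∀ x ∈ Set.Ioo (2 / 5 : ℝ) (3 / 5),
    (f : Equiv.Perm UnitAddCircle) (x : UnitAddCircle) = ((x + 1 / 100 : ℝ) : UnitAddCircle)

/-- `f` is a rotation `x ↦ x + α` with `α` irrational. -/
def CircleDiff.IsIrrationalRotation (f : CircleDiff) : Prop :=
  ∃ α : ℝ, Irrational α ∧
    ∀ x : UnitAddCircle, (f : Equiv.Perm UnitAddCircle) x = x + (α : UnitAddCircle)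

/-- The word metric `d_S(g₁, g₂)`: the infimum of all `k` such that
`g₂ = s₁^{±1} ⋯ s_k^{±1} g₁` with `s₁, …, s_k ∈ S` (and `⊤` if there is no such `k`). -/
noncomputable def wordDist {G : Type*} [Group G] (S : Set G) (g₁ g₂ : G) : ℕ∞ :=
  ⨅ (l : List G) (_ : (∀ s ∈ l, s ∈ S ∨ s⁻¹ ∈ S) ∧ g₂ = l.prod * g₁), (l.length : ℕ∞)

/-! All the `f n` are stored in the single diffeomorphism `F₄` and all the `g n` in `F₅`, as small
copies on pairwise disjoint arcs. Since `F₁` expands linearly around `1/2` with slope `t`, and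
rotation orbits are dense, the word `p = F₃ ^ i n * F₁⁻¹ ^ N n` is affine on `(1/7, 6/7)`: it
contracts by `μ n = t⁻¹ ^ N n` and recenters at `a n`. The word `q`, with `j n` in place of `i n`,
recenters at `b n`. On the `n`-th arcs, `F₄` is `p (f n) p⁻¹` and `F₅` is `q (g n) q⁻¹`.

Rescaling by `μ n` multiplies derivatives of order `r + 1` by `μ n ^ (-r)`. The arcs are fixed
before `f` and `g` are given, so `ε n` can be chosen small enough to compensate and make the sum of
all displacements smooth with derivative at most `1/2` (`exists_circleDiff_conj_on_arcs`).

The conjugate `p⁻¹ * F₄ * p` equals `f n` on `(1/7, 6/7)` but carries the other copies outside, and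
likewise for `q⁻¹ * F₅ * q`. The commutator removes this debris as soon as the two debris supports
are disjoint (`commutator_eq_of_eqOn`). Now `p` and `q` differ by the rotation by `a n - b n`, so it
suffices that `a k - b m` stays away from `a n - b n` whenever `k, m ≠ n`; `exists_arcs` achieves
this with centers near `1/2 ± 4 ^ (-(n+2))`. The commutator is then a word whose length depends only
on `i n`, `j n`, `N n`. -/

/-! ### Lifts and equality modulo `1`. -/

/-- A smooth function of positive derivative commuting with `x ↦ x + 1` is a lift of a circle
diffeomorphism. -/
theorem exists_isSmoothLift {F : ℝ → ℝ} (hs : ContDiff ℝ ∞ F) (hd : ∀ x, 0 < deriv F x)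
    (hF : ∀ x, F (x + 1) = F x + 1) :
    ∃ f : CircleDiff, IsSmoothLift F (f : Equiv.Perm UnitAddCircle) := by
  have hp : Function.Periodic (fun x => ((F x : ℝ) : UnitAddCircle)) 1 := by
    intro x
    simp [hF]
  have hl : IsSmoothLift F hp.lift := ⟨hs, hd, hF, fun x => hp.lift_coe x⟩
  have hinj : Function.Injective (hp.lift : UnitAddCircle → UnitAddCircle) := by
    intro x y
    obtain ⟨x, rfl⟩ := QuotientAddGroup.mk_surjective x
    obtain ⟨y, rfl⟩ := QuotientAddGroup.mk_surjective y
    intro h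
    have h' : ((F x : ℝ) : UnitAddCircle) = ((F y : ℝ) : UnitAddCircle) :=
      (hl.map_coe x).symm.trans (h.trans (hl.map_coe y))
    rw [← sub_eq_zero, ← AddCircle.coe_sub, AddCircle.coe_eq_zero_iff] at h'
    obtain ⟨n, hn⟩ := h'
    have hmono : StrictMono F := strictMono_of_deriv_pos hd
    have key : ∀ (a b : ℝ) (m : ℕ), F a - F b = m → (a : UnitAddCircle) = (b : UnitAddCircle) := by
      intro a b m hm
      have : F a = F (b + m) := by rw [hl.map_add_natCast]; linarith
      rw [hmono.injective this]
      have hz : ((m : ℝ) : UnitAddCircle) = 0 := by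
        rw [AddCircle.coe_eq_zero_iff]
        exact ⟨m, by simp⟩
      rw [AddCircle.coe_add, hz, add_zero]
    obtain ⟨m, rfl | rfl⟩ := n.eq_nat_or_neg
    · exact key x y m (by rw [← hn]; simp)
    · exact (key y x m (by simp at hn; linarith)).symm
  have hsurj : Function.Surjective (hp.lift : UnitAddCircle → UnitAddCircle) := by
    intro y
    obtain ⟨y, rfl⟩ := QuotientAddGroup.mk_surjective y
    obtain ⟨x, rfl⟩ := hl.surjective y
    exact ⟨(x : UnitAddCircle), hl.map_coe x⟩
  exact ⟨⟨Equiv.ofBijective _ ⟨hinj, hsurj⟩, F, hl⟩, hl⟩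

theorem UnitAddCircle.coe_eq_coe_iff {x y : ℝ} :
    (x : UnitAddCircle) = (y : UnitAddCircle) ↔ ∃ n : ℤ, x - y = n := by
  rw [← sub_eq_zero, ← AddCircle.coe_sub, AddCircle.coe_eq_zero_iff]
  constructor
  · rintro ⟨n, hn⟩
    exact ⟨n, by simpa using hn.symm⟩
  · rintro ⟨n, hn⟩
    exact ⟨n, by simpa using hn.symm⟩

theorem UnitAddCircle.eq_of_coe_eq {x y : ℝ} (h : (x : UnitAddCircle) = (y : UnitAddCircle))
    (hxy : |x - y| < 1) : x = y := by
  obtain ⟨n, hn⟩ := coe_eq_coe_iff.1 h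
  rw [hn] at hxy
  have : n = 0 := Int.abs_lt_one_iff.1 (by exact_mod_cast hxy)
  rw [this] at hn
  simpa [sub_eq_zero] using hn

/-- A continuous real function on an interval with integer values, vanishing at a point, is zero. -/
theorem eq_zero_of_integer_valued {u : ℝ → ℝ} (hu : Continuous u) {a b : ℝ}
    (hint : ∀ x ∈ Set.Icc a b, ∃ n : ℤ, u x = n) {x₀ : ℝ} (hx₀ : x₀ ∈ Set.Icc a b)
    (h0 : u x₀ = 0) : ∀ x ∈ Set.Icc a b, u x = 0 := by
  intro x hx
  obtain ⟨n, hn⟩ := hint x hx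
  rw [hn]
  by_contra hne
  have hpc : IsPreconnected (u '' Set.Icc a b) := isPreconnected_Icc.image _ hu.continuousOn
  have hoc := hpc.ordConnected
  have hm0 : (0 : ℝ) ∈ u '' Set.Icc a b := ⟨x₀, hx₀, h0⟩
  have hmn : (n : ℝ) ∈ u '' Set.Icc a b := ⟨x, hx, hn⟩
  have hn0 : n ≠ 0 := by exact_mod_cast hne
  have hhalf : ∃ m : ℤ, (m : ℝ) = 1 / 2 ∨ (m : ℝ) = -(1 / 2) := by
    rcases lt_or_gt_of_ne hn0 with h | h
    · have h1 : (n : ℝ) ≤ -1 := by exact_mod_cast (by omega : n ≤ -1)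
      obtain ⟨y, hy, hy'⟩ := hoc.out hmn hm0 (show -(1 / 2 : ℝ) ∈ _ from ⟨by linarith, by norm_num⟩)
      obtain ⟨m, hm⟩ := hint y hy
      exact ⟨m, Or.inr (by rw [← hm, hy'])⟩
    · have h1 : (1 : ℝ) ≤ n := by exact_mod_cast (by omega : 1 ≤ n)
      obtain ⟨y, hy, hy'⟩ := hoc.out hm0 hmn (show (1 / 2 : ℝ) ∈ _ from ⟨by norm_num, by linarith⟩)
      obtain ⟨m, hm⟩ := hint y hy
      exact ⟨m, Or.inl (by rw [← hm, hy'])⟩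
  obtain ⟨m, hm | hm⟩ := hhalf
  · have : (2 * m : ℝ) = 1 := by linarith
    have : 2 * m = 1 := by exact_mod_cast this
    omega
  · have : (2 * m : ℝ) = -1 := by linarith
    have : 2 * m = -1 := by exact_mod_cast this
    omega

/-! ### Passing between circle diffeomorphisms and displacement functions. -/

/-- The displacement of a diffeomorphism supported on an arc of `(0, 1)`, as a compactly supported
smooth function. -/
theorem CircleDiff.SupportedOn.exists_displacement {f : CircleDiff}
    (hf : f.SupportedOn (1 / 7) (6 / 7)) :
    ∃ ψ : ℝ → ℝ, ContDiff ℝ ∞ ψ ∧ (∀ x, x ∉ Set.Ioo (1 / 7 : ℝ) (6 / 7) → ψ x = 0) ∧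
      (∀ x ∈ Set.Ioo (1 / 7 : ℝ) (6 / 7), x + ψ x ∈ Set.Ioo (1 / 7 : ℝ) (6 / 7) ∧
        (f : Equiv.Perm UnitAddCircle) (x : UnitAddCircle) = ((x + ψ x : ℝ) : UnitAddCircle)) ∧
      ∀ (r : ℕ) (C : ℝ),
        (∀ x, |iteratedDeriv (r + 1) f.lift x - iteratedDeriv (r + 1) id x| ≤ C) →
        ∀ x, |iteratedDeriv (r + 1) ψ x| ≤ C := by
  have hF := f.isSmoothLift_lift
  set F := f.lift
  have hmono : StrictMono F := strictMono_of_deriv_pos hF.deriv_pos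
  have hfix : ∀ x ∈ Set.Icc (-(1 / 7) : ℝ) (1 / 7), ∃ n : ℤ, F x - x = n := by
    intro x hx
    apply UnitAddCircle.coe_eq_coe_iff.1
    rw [← hF.map_coe]
    apply hf
    rintro ⟨y, hy, hyx⟩
    obtain ⟨n, hn⟩ := UnitAddCircle.coe_eq_coe_iff.1 hyx
    have h1 : (0 : ℝ) < n := by rw [← hn]; linarith [hx.2, hy.1]
    have h2 : (n : ℝ) < 1 := by rw [← hn]; linarith [hx.1, hy.2]
    have h1' : 0 < n := by exact_mod_cast h1
    have h2' : n < 1 := by exact_mod_cast h2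
    omega
  obtain ⟨n₀, hn₀⟩ := hfix 0 (by norm_num)
  -- Subtracting the integer `n₀` selects the lift that fixes a neighbourhood of `0`.
  let u : ℝ → ℝ := fun x => F x - x - n₀
  have hus : ContDiff ℝ ∞ u := (hF.smooth.sub contDiff_id).sub contDiff_const
  have hu0 : ∀ x ∈ Set.Icc (-(1 / 7) : ℝ) (1 / 7), u x = 0 := by
    refine eq_zero_of_integer_valued hus.continuous ?_ (x₀ := 0) (by norm_num)
      (by simp only [u]; linarith)
    intro x hx
    obtain ⟨n, hn⟩ := hfix x hx
    exact ⟨n - n₀, by simp only [u]; rw [hn]; push_cast; ring⟩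
  have hu1 : ∀ x ∈ Set.Icc (6 / 7 : ℝ) (8 / 7), u x = 0 := by
    intro x hx
    have h := hu0 (x - 1) ⟨by linarith [hx.1], by linarith [hx.2]⟩
    have h2 := hF.map_add_one (x - 1)
    rw [sub_add_cancel] at h2
    simp only [u] at h ⊢
    linarith
  have hin : ∀ {x : ℝ}, x ∈ Set.Ioo (-(1 / 7) : ℝ) (8 / 7) → x ∉ Set.Ioo (1 / 7 : ℝ) (6 / 7) →
      u x = 0 := by
    intro x hx hx'
    by_cases h : x ≤ 1 / 7
    · exact hu0 x ⟨hx.1.le, h⟩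
    · refine hu1 x ⟨?_, hx.2.le⟩
      by_contra h2
      exact hx' ⟨not_le.1 h, not_le.1 h2⟩
  -- `u` is periodic; `ψ` keeps a single period of it. The cut is smooth because `u` vanishes on
  -- `[-1/7, 1/7]` and on `[6/7, 8/7]`.
  let ψ : ℝ → ℝ := (Set.Ioo (1 / 7 : ℝ) (6 / 7)).indicator u
  have hψ1 : ∀ x ∈ Set.Ioo (-(1 / 7) : ℝ) (8 / 7), ψ =ᶠ[nhds x] u := by
    intro x hx
    filter_upwards [isOpen_Ioo.mem_nhds hx] with y hy
    by_cases hy' : y ∈ Set.Ioo (1 / 7 : ℝ) (6 / 7)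
    · exact Set.indicator_of_mem hy' _
    · rw [hin hy hy']
      exact Set.indicator_of_notMem hy' _
  have hψ2 : ∀ x, x ∉ Set.Ioo (-(1 / 7) : ℝ) (8 / 7) → ψ =ᶠ[nhds x] fun _ => 0 := by
    intro x hx
    have : x ∈ (Set.Icc (1 / 7 : ℝ) (6 / 7))ᶜ := by
      intro h
      exact hx ⟨by linarith [h.1], by linarith [h.2]⟩
    filter_upwards [isClosed_Icc.isOpen_compl.mem_nhds this] with y hy
    exact Set.indicator_of_notMem (fun h => hy (Set.Ioo_subset_Icc_self h)) _
  refine ⟨ψ, ?_, fun x hx => Set.indicator_of_notMem hx _, ?_, ?_⟩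
  · rw [contDiff_iff_contDiffAt]
    intro x
    by_cases hx : x ∈ Set.Ioo (-(1 / 7) : ℝ) (8 / 7)
    · exact hus.contDiffAt.congr_of_eventuallyEq (hψ1 x hx)
    · exact contDiffAt_const.congr_of_eventuallyEq (hψ2 x hx)
  · intro x hx
    have he : x + ψ x = F x - n₀ := by
      simp only [ψ, Set.indicator_of_mem hx, u]
      ring
    have h1 := hu0 (1 / 7) (by norm_num)
    have h2 := hu1 (6 / 7) (by norm_num)
    have h3 := hmono hx.1
    have h4 := hmono hx.2
    simp only [u] at h1 h2
    refine ⟨?_, ?_⟩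
    · rw [he]
      exact ⟨by linarith, by linarith⟩
    · rw [hF.map_coe, he, UnitAddCircle.coe_eq_coe_iff]
      exact ⟨n₀, by ring⟩
  · intro r C hC x
    by_cases hx : x ∈ Set.Ioo (-(1 / 7) : ℝ) (8 / 7)
    · rw [(hψ1 x hx).iteratedDeriv_eq]
      have : iteratedDeriv (r + 1) u x
          = iteratedDeriv (r + 1) F x - iteratedDeriv (r + 1) id x := by
        have e : u = fun y => (F - id : ℝ → ℝ) y - (n₀ : ℝ) := rfl
        rw [← iteratedDeriv_sub (hF.smooth.of_le (by exact_mod_cast le_top)).contDiffAt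
          contDiff_id.contDiffAt, e, iteratedDeriv_succ', iteratedDeriv_succ']
        congr 1
        funext y
        exact deriv_sub_const _
      rw [this]
      exact hC x
    · rw [(hψ2 x hx).iteratedDeriv_eq]
      simpa using (abs_nonneg _).trans (hC x)

/-- The periodization of a function supported in the interior of a fundamental domain is locally
a translate of it. -/
theorem eventuallyEq_comp_fract {φ : ℝ → ℝ} (h0 : ∀ x, x ∉ Set.Icc (1 / 4 : ℝ) (3 / 4) → φ x = 0)
    (x : ℝ) : (fun y => φ (Int.fract y)) =ᶠ[nhds x] fun y => φ (y - ⌊x⌋) := by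
  -- On this window the floor of `y` can differ from that of `x` by one, but then both arguments of
  -- `φ` fall in the margins outside `[1/4, 3/4]`.
  have hx : x ∈ Set.Ioo ((⌊x⌋ : ℝ) - 1 / 4) (⌊x⌋ + 5 / 4) :=
    ⟨by linarith [Int.floor_le x], by linarith [Int.lt_floor_add_one x]⟩
  filter_upwards [isOpen_Ioo.mem_nhds hx] with y hy
  rcases lt_or_ge y ⌊x⌋ with h | h
  · have hf : ⌊y⌋ = ⌊x⌋ - 1 := by
      rw [Int.floor_eq_iff]
      push_cast
      exact ⟨by linarith [hy.1], by linarith⟩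
    rw [h0 (y - ⌊x⌋) (fun h' => by linarith [h'.1]), h0]
    intro h'
    have := h'.2
    rw [Int.fract, hf] at this
    push_cast at this
    linarith [hy.1]
  · rcases lt_or_ge y (⌊x⌋ + 1) with h2 | h2
    · have hf : ⌊y⌋ = ⌊x⌋ := Int.floor_eq_iff.2 ⟨h, h2⟩
      rw [Int.fract, hf]
    · have hf : ⌊y⌋ = ⌊x⌋ + 1 := by
        rw [Int.floor_eq_iff]
        push_cast
        exact ⟨by linarith, by linarith [hy.2]⟩
      rw [h0 (y - ⌊x⌋) (fun h' => by linarith [h'.2]), h0]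
      intro h'
      have := h'.1
      rw [Int.fract, hf] at this
      push_cast at this
      linarith [hy.2]

/-- A smooth displacement supported in `[1/4, 3/4]` with small derivative defines a circle
diffeomorphism. -/
theorem exists_circleDiff_of_displacement {φ : ℝ → ℝ} (hs : ContDiff ℝ ∞ φ)
    (h0 : ∀ x, x ∉ Set.Icc (1 / 4 : ℝ) (3 / 4) → φ x = 0) (hd : ∀ x, |deriv φ x| ≤ 1 / 2) :
    ∃ F : CircleDiff, ∀ x ∈ Set.Ico (0 : ℝ) 1,
      (F : Equiv.Perm UnitAddCircle) (x : UnitAddCircle) = ((x + φ x : ℝ) : UnitAddCircle) := by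
  have hp : ContDiff ℝ ∞ fun x => φ (Int.fract x) := by
    rw [contDiff_iff_contDiffAt]
    intro x
    refine ContDiffAt.congr_of_eventuallyEq ?_ (eventuallyEq_comp_fract h0 x)
    exact (hs.comp (contDiff_id.sub contDiff_const)).contDiffAt
  have hpos : ∀ x, 0 < deriv (fun x => x + φ (Int.fract x)) x := by
    intro x
    rw [deriv_fun_add differentiableAt_fun_id (hp.differentiable (by simp) x), deriv_id'',
      (eventuallyEq_comp_fract h0 x).deriv_eq, deriv_comp_sub_const]
    linarith [neg_abs_le (deriv φ (x - ⌊x⌋)), hd (x - ⌊x⌋)]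
  obtain ⟨F, hF⟩ := exists_isSmoothLift (F := fun x => x + φ (Int.fract x))
    (contDiff_id.add hp) hpos (fun x => by simp only [Int.fract_add_one]; ring)
  refine ⟨F, fun x hx => ?_⟩
  rw [hF.map_coe, Int.fract_eq_self.2 hx]

/-! ### Rescaled copies and their assembly on disjoint arcs. -/

theorem iteratedDeriv_rescale {ψ : ℝ → ℝ} (hψ : ContDiff ℝ ∞ ψ) (μ s : ℝ) (r : ℕ) (x : ℝ) :
    iteratedDeriv r (fun x => μ * ψ (μ⁻¹ * x + s)) x =
      μ * (μ⁻¹ ^ r * iteratedDeriv r ψ (μ⁻¹ * x + s)) := by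
  have h1 : ContDiff ℝ r fun z => ψ (z + s) :=
    (hψ.comp (contDiff_id.add contDiff_const)).of_le (by exact_mod_cast le_top)
  rw [iteratedDeriv_const_mul_field,
    iteratedDeriv_comp_const_mul (f := fun z => ψ (z + s)) h1 μ⁻¹, iteratedDeriv_comp_add_const]

/-- Derivative bounds for the rescaling by `μ` of a function supported in `(1/7, 6/7)`. -/
theorem abs_iteratedDeriv_rescale_le {ψ : ℝ → ℝ} (hψ : ContDiff ℝ ∞ ψ)
    (h0 : ∀ x, x ∉ Set.Ioo (1 / 7 : ℝ) (6 / 7) → ψ x = 0) {μ η : ℝ} (hμ : 0 < μ) (hμ1 : μ ≤ 1)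
    {n : ℕ} (hη : 0 ≤ η)
    (hsmall : ∀ r ≤ n, ∀ x, |iteratedDeriv (r + 1) ψ x| ≤ μ ^ n * η) (s : ℝ) :
    ∀ r ≤ n + 1, ∀ x, |iteratedDeriv r (fun x => μ * ψ (μ⁻¹ * x + s)) x| ≤ η := by
  have hpow : ∀ k : ℕ, μ ^ k * η ≤ η := fun k =>
    mul_le_of_le_one_left hη (pow_le_one₀ hμ.le hμ1)
  have hψ0 : ∀ x, |ψ x| ≤ η := by
    intro x
    by_cases hx : x ∈ Set.Ioo (1 / 7 : ℝ) (6 / 7)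
    -- Order `0` is not among the hypotheses: it follows from the mean value inequality, as `ψ 0 =
    -- 0` and `|x| < 1`.
    · have := Convex.norm_image_sub_le_of_norm_deriv_le (𝕜 := ℝ) (f := ψ) (C := η)
        (s := Set.univ) (x := 0) (y := x)
        (fun y _ => hψ.differentiable (by simp) y)
        (fun y _ => by
          have := hsmall 0 (Nat.zero_le _) y
          rw [zero_add, iteratedDeriv_one] at this
          exact this.trans (hpow n)) convex_univ (Set.mem_univ _) (Set.mem_univ _)
      rw [h0 0 (by norm_num), sub_zero, sub_zero, Real.norm_eq_abs, Real.norm_eq_abs] at this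
      refine this.trans (mul_le_of_le_one_right hη ?_)
      rw [abs_le]
      exact ⟨by linarith [hx.1], by linarith [hx.2]⟩
    · rw [h0 x hx, abs_zero]
      exact hη
  intro r hr x
  rw [iteratedDeriv_rescale hψ]
  rcases r with _ | r
  · rw [pow_zero, one_mul, iteratedDeriv_zero, abs_mul, abs_of_pos hμ]
    exact (mul_le_mul hμ1 (hψ0 _) (abs_nonneg _) zero_le_one).trans_eq (one_mul _)
  -- The outer factor `μ` absorbs one `μ⁻¹`, so order `r + 1` costs only `μ⁻¹ ^ r`, which `μ ^ n`
  -- pays for since `r ≤ n`.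
  · have e : μ * (μ⁻¹ ^ (r + 1) * iteratedDeriv (r + 1) ψ (μ⁻¹ * x + s)) =
        μ⁻¹ ^ r * iteratedDeriv (r + 1) ψ (μ⁻¹ * x + s) := by
      rw [pow_succ]
      field_simp
    have hrn : r ≤ n := by omega
    rw [e, abs_mul, abs_of_pos (pow_pos (inv_pos.2 hμ) r)]
    calc μ⁻¹ ^ r * |iteratedDeriv (r + 1) ψ (μ⁻¹ * x + s)|
        ≤ μ⁻¹ ^ r * (μ ^ n * η) :=
          mul_le_mul_of_nonneg_left (hsmall r hrn _) (pow_pos (inv_pos.2 hμ) r).le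
      _ = μ ^ (n - r) * η := by
          rw [← Nat.sub_add_cancel hrn, pow_add, Nat.add_sub_cancel]
          rw [mul_assoc, inv_pow, mul_left_comm,
            inv_mul_cancel_left₀ (pow_pos hμ r).ne']
      _ ≤ η := hpow _

theorem mem_Ioo_of_rescale {c μ z : ℝ} (hμ : 0 < μ) (hz : z ∈ Set.Ioo (1 / 7 : ℝ) (6 / 7)) :
    c + μ * (z - 1 / 2) ∈ Set.Ioo (c - μ / 2) (c + μ / 2) := by
  have h1 := mul_lt_mul_of_pos_left hz.1 hμ
  have h2 := mul_lt_mul_of_pos_left hz.2 hμ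
  constructor <;> linarith

/-- Rescaled copies of sufficiently small diffeomorphisms `f n`, placed on disjoint arcs with
centers `c n` and lengths `μ n`, assemble to a single circle diffeomorphism. -/
theorem exists_circleDiff_conj_on_arcs {c μ : ℕ → ℝ} (hμ : ∀ n, 0 < μ n) (hμ1 : ∀ n, μ n ≤ 1)
    (hc : ∀ n, 1 / 4 ≤ c n - μ n / 2 ∧ c n + μ n / 2 ≤ 3 / 4)
    (hdisj : ∀ m n, m ≠ n → (μ m + μ n) / 2 ≤ |c m - c n|) {f : ℕ → CircleDiff}
    (hf : ∀ n, (f n).SupportedOn (1 / 7) (6 / 7))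
    (hsmall : ∀ n, ∀ r ≤ n, ∀ x,
      |iteratedDeriv (r + 1) (f n).lift x - iteratedDeriv (r + 1) id x| ≤
        μ n ^ n * (1 / 4 * (1 / 2) ^ n)) :
    ∃ F : CircleDiff,
      (∀ n, ∀ h : Equiv.Perm UnitAddCircle,
        (∀ z ∈ Set.Ioo (1 / 7 : ℝ) (6 / 7),
          h (z : UnitAddCircle) = ((c n + μ n * (z - 1 / 2) : ℝ) : UnitAddCircle)) →
        ∀ z ∈ Set.Ioo (1 / 7 : ℝ) (6 / 7), (F : Equiv.Perm UnitAddCircle) (h (z : UnitAddCircle)) =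
          h ((f n : Equiv.Perm UnitAddCircle) (z : UnitAddCircle))) ∧
      ∀ x : UnitAddCircle, (F : Equiv.Perm UnitAddCircle) x ≠ x →
        ∃ n, ∃ z ∈ Set.Ioo (1 / 7 : ℝ) (6 / 7),
          x = ((c n + μ n * (z - 1 / 2) : ℝ) : UnitAddCircle) := by
  choose ψ hψs hψ0 hψf hψd using fun n => (hf n).exists_displacement
  -- Displacement of the conjugate of `f n` by `z ↦ c n + μ n * (z - 1/2)`.
  let φ : ℕ → ℝ → ℝ := fun n x => μ n * ψ n ((μ n)⁻¹ * x + (1 / 2 - (μ n)⁻¹ * c n))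
  have hφs : ∀ n, ContDiff ℝ ∞ (φ n) := fun n =>
    contDiff_const.mul ((hψs n).comp ((contDiff_const.mul contDiff_id).add contDiff_const))
  have hφ1 : ∀ n x, φ n x ≠ 0 → ∃ z ∈ Set.Ioo (1 / 7 : ℝ) (6 / 7), x = c n + μ n * (z - 1 / 2) := by
    intro n x hx
    refine ⟨(μ n)⁻¹ * x + (1 / 2 - (μ n)⁻¹ * c n), ?_, ?_⟩
    · by_contra h
      exact hx (by simp only [φ, hψ0 n _ h, mul_zero])
    · have := (hμ n).ne'
      field_simp
      ring
  have hφ0 : ∀ n x, x ∉ Set.Ioo (c n - μ n / 2) (c n + μ n / 2) → φ n x = 0 := by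
    intro n x hx
    by_contra h
    obtain ⟨z, hz, rfl⟩ := hφ1 n x h
    exact hx (mem_Ioo_of_rescale (hμ n) hz)
  have hφb : ∀ n, ∀ r ≤ n + 1, ∀ x, |iteratedDeriv r (φ n) x| ≤ 1 / 4 * (1 / 2 : ℝ) ^ n := fun n =>
    abs_iteratedDeriv_rescale_le (hψs n) (hψ0 n) (hμ n) (hμ1 n) (by positivity)
      (fun r hr => hψd n r _ (hsmall n r hr)) _
  have hsum : Summable fun n : ℕ => 1 / 4 * (1 / 2 : ℝ) ^ n := summable_geometric_two.mul_left _
  have hφd : ∀ n x, ‖deriv (φ n) x‖ ≤ 1 / 4 * (1 / 2 : ℝ) ^ n := by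
    intro n x
    have := hφb n 1 (by omega) x
    rwa [iteratedDeriv_one] at this
  have hφz : Summable fun n => φ n 0 := by
    refine summable_of_ne_finset_zero (s := ∅) fun n _ => hφ0 n 0 fun h => ?_
    linarith [h.1, (hc n).1]
  have hΦs : ContDiff ℝ ∞ fun x => ∑' n, φ n x := by
    -- The `n`-th term is controlled only up to order `n + 1`; for each order `k` this leaves out
    -- finitely many terms, which are smooth anyway.
    refine contDiff_tsum_of_eventually (N := (⊤ : ℕ∞)) (v := fun _ n => 1 / 4 * (1 / 2 : ℝ) ^ n)
      hφs (fun _ _ => hsum) ?_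
    intro k _
    rw [Nat.cofinite_eq_atTop]
    filter_upwards [Filter.eventually_ge_atTop k] with n hn x
    rw [norm_iteratedFDeriv_eq_norm_iteratedDeriv]
    exact hφb n k (by omega) x
  have hΦ0 : ∀ x, x ∉ Set.Icc (1 / 4 : ℝ) (3 / 4) → ∑' n, φ n x = 0 := by
    intro x hx
    have : ∀ n, φ n x = 0 := fun n => hφ0 n x fun h =>
      hx ⟨by linarith [h.1, (hc n).1], by linarith [h.2, (hc n).2]⟩
    simp [this]
  have hΦd : ∀ x, |deriv (fun x => ∑' n, φ n x) x| ≤ 1 / 2 := by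
    intro x
    rw [deriv_tsum_apply hsum (fun n => (hφs n).differentiable (by simp)) hφd hφz,
      ← Real.norm_eq_abs]
    -- The factor `1/4` makes the geometric series sum to exactly `1/2`.
    refine tsum_of_norm_bounded ?_ fun n => hφd n x
    have := hasSum_geometric_two.mul_left (1 / 4 : ℝ)
    norm_num at this ⊢
    exact this
  obtain ⟨F, hF⟩ := exists_circleDiff_of_displacement hΦs hΦ0 hΦd
  have hval : ∀ n, ∀ x ∈ Set.Ioo (c n - μ n / 2) (c n + μ n / 2),
      (F : Equiv.Perm UnitAddCircle) (x : UnitAddCircle) = ((x + φ n x : ℝ) : UnitAddCircle) := by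
    intro n x hx
    rw [hF x ⟨by linarith [hx.1, (hc n).1], by linarith [hx.2, (hc n).2]⟩,
      tsum_eq_single n]
    intro m hm
    apply hφ0
    intro hx'
    have h1 := hdisj m n hm
    have h2 : |c m - c n| < (μ m + μ n) / 2 := by
      rw [abs_lt]
      exact ⟨by linarith [hx.1, hx'.2], by linarith [hx.2, hx'.1]⟩
    linarith
  refine ⟨F, fun n h hh z hz => ?_, fun x hx => ?_⟩
  · have hz' := mem_Ioo_of_rescale (c := c n) (hμ n) hz
    rw [hh z hz, hval n _ hz', (hψf n z hz).2, hh _ (hψf n z hz).1]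
    congr 1
    have e : (μ n)⁻¹ * (c n + μ n * (z - 1 / 2)) + (1 / 2 - (μ n)⁻¹ * c n) = z := by
      have := (hμ n).ne'
      field_simp
      ring
    simp only [φ, e]
    ring
  · obtain ⟨x, rfl⟩ := QuotientAddGroup.mk_surjective x
    have hxf : ((Int.fract x : ℝ) : UnitAddCircle) = (x : UnitAddCircle) :=
      UnitAddCircle.coe_eq_coe_iff.2 ⟨-⌊x⌋, by rw [Int.fract]; push_cast; ring⟩
    have := hF (Int.fract x) ⟨Int.fract_nonneg x, Int.fract_lt_one x⟩
    rw [hxf] at this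
    by_contra! hall
    have hz : ∀ n, φ n (Int.fract x) = 0 := by
      intro n
      by_contra h
      obtain ⟨z, hz, e⟩ := hφ1 n _ h
      exact hall n z hz (by rw [← e, hxf])
    simp only [hz, tsum_zero, add_zero] at this
    exact hx (this.trans hxf)

/-! ### The commutator identity and word lengths. -/

/-- If `A` and `B` agree on `U` with permutations `f` and `g` supported on `U`, and their supports
are disjoint outside `U`, then the commutators of `A, B` and of `f, g` agree. -/
theorem commutator_eq_of_eqOn {X : Type*} {A B f g : Equiv.Perm X} {U : Set X}
    (hf : ∀ x, x ∉ U → f x = x) (hg : ∀ x, x ∉ U → g x = x) (hA : ∀ x ∈ U, A x = f x)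
    (hB : ∀ x ∈ U, B x = g x) (hAB : ∀ x, x ∉ U → A x = x ∨ B x = x) :
    A * B * A⁻¹ * B⁻¹ = f * g * f⁻¹ * g⁻¹ := by
  -- `A'` and `B'` are the debris: both are trivial on `U`, hence commute with `f` and `g`, and by
  -- `hAB` they commute with each other.
  obtain ⟨A', rfl⟩ : ∃ A', A = f * A' := ⟨f⁻¹ * A, by group⟩
  obtain ⟨B', rfl⟩ : ∃ B', B = g * B' := ⟨g⁻¹ * B, by group⟩
  simp only [Equiv.Perm.mul_apply, EmbeddingLike.apply_eq_iff_eq] at hA hB hAB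
  have hf' : ∀ x y, x ∉ U → f y = x → y = x := fun x y hx h => f.injective (h.trans (hf x hx).symm)
  have hg' : ∀ x y, x ∉ U → g y = x → y = x := fun x y hx h => g.injective (h.trans (hg x hx).symm)
  have off : ∀ {C : Equiv.Perm X}, (∀ x ∈ U, C x = x) → ∀ {k : Equiv.Perm X},
      (∀ x, x ∉ U → k x = x) → Commute C k := by
    intro C hC k hk
    refine Equiv.Perm.Disjoint.commute fun x => ?_
    by_cases hx : x ∈ U
    · exact Or.inl (hC x hx)
    · exact Or.inr (hk x hx)
  have cAB : Commute A' B' := by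
    refine Equiv.Perm.Disjoint.commute fun x => ?_
    by_cases hx : x ∈ U
    · exact Or.inl (hA x hx)
    · exact (hAB x hx).imp (hf' x _ hx) (hg' x _ hx)
  have e1 : A' * g * A'⁻¹ = g := by rw [(off hA hg).eq]; group
  have e2 : A' * B' * A'⁻¹ = B' := by rw [cAB.eq]; group
  have e3 : B' * f⁻¹ * B'⁻¹ = f⁻¹ := by rw [((off hB hf).inv_right).eq]; group
  calc f * A' * (g * B') * (f * A')⁻¹ * (g * B')⁻¹
      = f * (A' * g * A'⁻¹) * ((A' * B' * A'⁻¹) * f⁻¹ * B'⁻¹) * g⁻¹ := by group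
    _ = f * g * f⁻¹ * g⁻¹ := by rw [e1, e2, e3]

/-- `g` is a product of at most `k` elements of `S` and their inverses. -/
def IsWordOfLengthLE {G : Type*} [Group G] (S : Set G) (g : G) (k : ℕ) : Prop :=
  ∃ l : List G, (∀ s ∈ l, s ∈ S ∨ s⁻¹ ∈ S) ∧ l.prod = g ∧ l.length ≤ k

namespace IsWordOfLengthLE

variable {G : Type*} [Group G] {S : Set G} {g h : G} {k m : ℕ}

theorem of_mem (hg : g ∈ S) : IsWordOfLengthLE S g 1 :=
  ⟨[g], by simp [hg], by simp, by simp⟩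

theorem mul (hg : IsWordOfLengthLE S g k) (hh : IsWordOfLengthLE S h m) :
    IsWordOfLengthLE S (g * h) (k + m) := by
  obtain ⟨l, hl, rfl, hk⟩ := hg
  obtain ⟨l', hl', rfl, hm⟩ := hh
  refine ⟨l ++ l', fun s hs => ?_, by simp, by rw [List.length_append]; omega⟩
  exact (List.mem_append.1 hs).elim (hl s) (hl' s)

theorem inv (hg : IsWordOfLengthLE S g k) : IsWordOfLengthLE S g⁻¹ k := by
  obtain ⟨l, hl, rfl, hk⟩ := hg
  refine ⟨(l.map fun x => x⁻¹).reverse, fun s hs => ?_, (List.prod_inv_reverse l).symm, by simpa⟩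
  rw [List.mem_reverse, List.mem_map] at hs
  obtain ⟨t, ht, rfl⟩ := hs
  rw [inv_inv]
  exact (hl t ht).symm

theorem pow (hg : IsWordOfLengthLE S g 1) (n : ℕ) : IsWordOfLengthLE S (g ^ n) n := by
  induction n with
  | zero => exact ⟨[], by simp, by simp, by simp⟩
  | succ n ih => rw [pow_succ]; exact ih.mul hg

theorem zpow (hg : IsWordOfLengthLE S g 1) (n : ℤ) : IsWordOfLengthLE S (g ^ n) n.natAbs := by
  obtain ⟨m, rfl | rfl⟩ := n.eq_nat_or_neg
  · simpa using hg.pow m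
  · simpa using (hg.pow m).inv

theorem mem_closure (hg : IsWordOfLengthLE S g k) : g ∈ Subgroup.closure S := by
  obtain ⟨l, hl, rfl, -⟩ := hg
  refine list_prod_mem fun s hs => ?_
  rcases hl s hs with h | h
  · exact Subgroup.subset_closure h
  · exact inv_mem_iff.1 (Subgroup.subset_closure h)

theorem wordDist_le (hg : IsWordOfLengthLE S g k) : wordDist S g 1 ≤ k := by
  -- In `wordDist S g 1` the word takes `g` to `1`, so it spells `g⁻¹`.
  obtain ⟨l, hl, he, hk⟩ := hg.inv
  refine iInf₂_le_of_le l ⟨hl, ?_⟩ (by exact_mod_cast hk)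
  rw [he, inv_mul_cancel]

end IsWordOfLengthLE

/-! ### From the metric to derivative bounds. -/

/-- Derivatives of lifts are uniformly close to those of the identity near the identity. -/
theorem eventually_abs_iteratedDeriv_lift_sub_le (n : ℕ) {δ : ℝ} (hδ : 0 < δ) :
    ∀ᶠ f in @nhds CircleDiff CircleDiff.smoothTopology 1, ∀ r ≤ n, ∀ x,
      |iteratedDeriv (r + 1) f.lift x - iteratedDeriv (r + 1) id x| ≤ δ := by
  have hid : IsSmoothLift id ((1 : CircleDiff) : Equiv.Perm UnitAddCircle) :=
    ⟨contDiff_id, by simp, by simp, by simp⟩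
  refine (Filter.eventually_all_finite (Set.finite_Iic n)).2 fun r _ => ?_
  have hle : @nhds CircleDiff CircleDiff.smoothTopology 1 ≤ Filter.comap
      (fun f : CircleDiff => UniformFun.ofFun (iteratedDeriv (r + 1) f.lift))
      (nhds (UniformFun.ofFun (iteratedDeriv (r + 1) (1 : CircleDiff).lift))) := by
    rw [← nhds_induced]
    exact nhds_mono (inf_le_right.trans (iInf_le _ r))
  refine hle ?_
  have hb := (UniformFun.hasBasis_nhds_of_basis ℝ ℝ
    (UniformFun.ofFun (iteratedDeriv (r + 1) (1 : CircleDiff).lift))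
    Metric.uniformity_basis_dist).comap
      (fun f : CircleDiff => UniformFun.ofFun (iteratedDeriv (r + 1) f.lift))
  refine hb.mem_of_mem hδ |> Filter.mem_of_superset <| fun f hf x => ?_
  have := hf x
  -- The chosen lift of `1` may be a translate of `id` by an integer, which derivatives of positive
  -- order do not see.
  rw [← (1 : CircleDiff).isSmoothLift_lift.iteratedDeriv_eq hid r, ← Real.dist_eq, dist_comm]
  exact le_of_lt this

/-- Source of the `ε n` of the theorem: the metric matters only through its topology, and the radius
does not depend on `f`. -/
theorem exists_dist_lt_imp_abs_iteratedDeriv_lift_sub_le (d : MetricSpace CircleDiff)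
    (hd : d.toUniformSpace.toTopologicalSpace = CircleDiff.smoothTopology) (n : ℕ) {δ : ℝ}
    (hδ : 0 < δ) :
    ∃ ε > 0, ∀ f : CircleDiff, d.dist f 1 < ε → ∀ r ≤ n, ∀ x,
      |iteratedDeriv (r + 1) f.lift x - iteratedDeriv (r + 1) id x| ≤ δ := by
  have h := eventually_abs_iteratedDeriv_lift_sub_le n hδ
  rw [← hd] at h
  obtain ⟨ε, hε, h⟩ := Metric.eventually_nhds_iff.1 h
  exact ⟨ε, hε, fun f hf => h hf⟩

/-! ### Dynamics of `F₁` and `F₃`. -/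

/-- The inverse iterates of a repeller-attractor map contract linearly to the repeller `1/2`. -/
theorem CircleDiff.inv_pow_apply_coe {F : CircleDiff} {a : ℝ} (ha : 1 < a)
    (hF : ∀ x ∈ Set.Ioo (1 / 10 : ℝ) (9 / 10), (F : Equiv.Perm UnitAddCircle) (x : UnitAddCircle) =
      ((1 / 2 + a * (x - 1 / 2) : ℝ) : UnitAddCircle)) (N : ℕ) {z : ℝ}
    (hz : z ∈ Set.Ioo (1 / 10 : ℝ) (9 / 10)) :
    ((F⁻¹ ^ N : CircleDiff) : Equiv.Perm UnitAddCircle) (z : UnitAddCircle) =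
      ((1 / 2 + a⁻¹ ^ N * (z - 1 / 2) : ℝ) : UnitAddCircle) := by
  have ha0 : 0 < a := by linarith
  have hai : a⁻¹ ≤ 1 := inv_le_one_of_one_le₀ ha.le
  -- Contraction towards `1/2` never leaves the arc where `F` is affine, so the formula iterates.
  have hmem : ∀ {t : ℝ}, 0 < t → t ≤ 1 → ∀ {y : ℝ}, y ∈ Set.Ioo (1 / 10 : ℝ) (9 / 10) →
      1 / 2 + t * (y - 1 / 2) ∈ Set.Ioo (1 / 10 : ℝ) (9 / 10) := by
    intro t ht ht1 y hy
    have h1 := mul_lt_mul_of_pos_left hy.1 ht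
    have h2 := mul_lt_mul_of_pos_left hy.2 ht
    constructor <;> linarith
  induction N with
  | zero => simp
  | succ N ih =>
    rw [pow_succ', Subgroup.coe_mul, Equiv.Perm.mul_apply, ih, Subgroup.coe_inv,
      Equiv.Perm.inv_eq_iff_eq]
    have hy := hmem (pow_pos (inv_pos.2 ha0) (N + 1)) (pow_le_one₀ (inv_pos.2 ha0).le hai) hz
    rw [hF _ hy]
    congr 1
    rw [pow_succ']
    field_simp
    ring

theorem CircleDiff.zpow_apply_of_rotation {F : CircleDiff} {α : ℝ}
    (hF : ∀ x : UnitAddCircle, (F : Equiv.Perm UnitAddCircle) x = x + (α : UnitAddCircle)) (j : ℤ)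
    (x : UnitAddCircle) :
    ((F ^ j : CircleDiff) : Equiv.Perm UnitAddCircle) x = x + ((j * α : ℝ) : UnitAddCircle) := by
  have hF' : ∀ x : UnitAddCircle,
      ((F⁻¹ : CircleDiff) : Equiv.Perm UnitAddCircle) x = x - (α : UnitAddCircle) := by
    intro x
    rw [Subgroup.coe_inv, Equiv.Perm.inv_eq_iff_eq, hF, sub_add_cancel]
  induction j with
  | zero => simp
  | succ n ih =>
    rw [zpow_add_one, (Commute.zpow_self F n).eq, Subgroup.coe_mul, Equiv.Perm.mul_apply, ih, hF,
      add_assoc, ← AddCircle.coe_add]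
    push_cast
    ring_nf
  | pred n ih =>
    rw [zpow_sub_one, ((Commute.zpow_self F (-n)).inv_right).eq, Subgroup.coe_mul,
      Equiv.Perm.mul_apply, ih, hF', add_sub_assoc, ← AddCircle.coe_sub]
    push_cast
    ring_nf

/-- The orbit of `1/2` under an irrational rotation is dense. -/
theorem exists_orbit_near {α : ℝ} (hα : Irrational α) (t : ℝ) {ε : ℝ} (hε : 0 < ε) :
    ∃ (j : ℤ) (c : ℝ), |c - t| ≤ ε ∧
      (c : UnitAddCircle) = ((1 / 2 : ℝ) : UnitAddCircle) + ((j * α : ℝ) : UnitAddCircle) := by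
  have hd : Dense (AddSubgroup.closure {α, 1} : Set ℝ) :=
    dense_addSubgroupClosure_pair_iff.2 (by simpa using hα)
  obtain ⟨s, hs, hst⟩ := Metric.dense_iff.1 hd (t - 1 / 2) ε hε
  obtain ⟨j, n, rfl⟩ := AddSubgroup.mem_closure_pair.1 hst
  refine ⟨j, 1 / 2 + (j * α + n), ?_, ?_⟩
  · rw [Metric.mem_ball, Real.dist_eq] at hs
    simp only [zsmul_eq_mul, mul_one] at hs
    rw [show 1 / 2 + (j * α + n) - t = j * α + n - (t - 1 / 2) by ring]
    exact hs.le
  · rw [← AddCircle.coe_add, UnitAddCircle.coe_eq_coe_iff]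
    exact ⟨n, by ring⟩

/-! ### Choice and separation of the arcs. -/

/-- Two sequences of disjoint arcs with centers `a n`, `b n` in the orbit of `1/2` under a rotation
and small lengths `μ n = t ^ N n`, such that the rotation taking the `n`-th arc of the second family
to the `n`-th arc of the first one makes all the other arcs disjoint. -/
theorem exists_arcs {α t : ℝ} (hα : Irrational α) (ht : 0 < t) (ht1 : t < 1) :
    ∃ (i j : ℕ → ℤ) (N : ℕ → ℕ) (a b : ℕ → ℝ),
      (∀ n, (a n : UnitAddCircle) = ((1 / 2 : ℝ) : UnitAddCircle) + ((i n * α : ℝ) : UnitAddCircle)) ∧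
      (∀ n, (b n : UnitAddCircle) = ((1 / 2 : ℝ) : UnitAddCircle) + ((j n * α : ℝ) : UnitAddCircle)) ∧
      (∀ n, 1 / 4 ≤ a n - t ^ N n / 2 ∧ a n + t ^ N n / 2 ≤ 3 / 4) ∧
      (∀ n, 1 / 4 ≤ b n - t ^ N n / 2 ∧ b n + t ^ N n / 2 ≤ 3 / 4) ∧
      (∀ m n, m ≠ n → (t ^ N m + t ^ N n) / 2 ≤ |a m - a n|) ∧
      (∀ m n, m ≠ n → (t ^ N m + t ^ N n) / 2 ≤ |b m - b n|) ∧
      ∀ n k m, k ≠ n → m ≠ n →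
        (t ^ N k + t ^ N m) / 2 ≤ |(a k - b m) - (a n - b n)| := by
  -- Centers lie near `1/2 + x n` and `1/2 - x n`, with errors and lengths at most `x n / 100`; the
  -- ratio `1/4` leaves room for these errors in every comparison below.
  let x : ℕ → ℝ := fun n => (1 / 4) ^ (n + 2)
  have hx0 : ∀ n, 0 < x n := fun n => by positivity
  have hxlt : ∀ {m n}, m < n → x n ≤ x m / 4 := by
    intro m n h
    have : x n ≤ (1 / 4 : ℝ) ^ (m + 2 + 1) :=
      pow_le_pow_of_le_one (by norm_num) (by norm_num) (by omega)
    rw [pow_succ] at this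
    simp only [x] at this ⊢
    linarith
  have hx1 : ∀ n, x n ≤ 1 / 16 := by
    intro n
    have : x n ≤ (1 / 4 : ℝ) ^ 2 := pow_le_pow_of_le_one (by norm_num) (by norm_num) (by omega)
    norm_num at this ⊢
    exact this
  have hx100 : ∀ n, 0 < x n / 100 := fun n => by linarith [hx0 n]
  choose i a ha hi using fun n => exists_orbit_near hα (1 / 2 + x n) (hx100 n)
  choose j b hb hj using fun n => exists_orbit_near hα (1 / 2 - x n) (hx100 n)
  choose N hN using fun n => exists_pow_lt_of_lt_one (hx100 n) ht1
  simp only [abs_le] at ha hb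
  have hμ : ∀ n, 0 < t ^ N n := fun n => pow_pos ht _
  have hlta : ∀ {m n}, m < n → (t ^ N m + t ^ N n) / 2 ≤ a m - a n := by
    intro m n h
    linarith [ha m, ha n, hN m, hN n, hxlt h, hx0 n, hx0 m]
  have hltb : ∀ {m n}, m < n → (t ^ N m + t ^ N n) / 2 ≤ b n - b m := by
    intro m n h
    linarith [hb m, hb n, hN m, hN n, hxlt h, hx0 n, hx0 m]
  refine ⟨i, j, N, a, b, hi, hj, fun n => ?_, fun n => ?_, fun m n h => ?_, fun m n h => ?_,
    fun n k m hk hm => ?_⟩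
  · constructor <;> linarith [ha n, hN n, hx1 n, hx0 n]
  · constructor <;> linarith [hb n, hN n, hx1 n, hx0 n]
  · rw [le_abs]
    rcases lt_or_gt_of_ne h with h | h
    · exact Or.inl (hlta h)
    · exact Or.inr (by linarith [hlta h])
  · rw [le_abs]
    rcases lt_or_gt_of_ne h with h | h
    · exact Or.inr (by linarith [hltb h])
    · exact Or.inl (by linarith [hltb h])
  -- Up to errors, `x k + x m` is compared with `2 * x n`. If `k < n` or `m < n`, one summand is
  -- already at least `4 * x n`; otherwise the sum is at most `x n / 2`.
  · rw [le_abs]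
    rcases lt_or_gt_of_ne hk with h | h
    · left
      linarith [ha k, hb m, ha n, hb n, hN k, hN m, hxlt h, hx0 m, hx0 n, hx0 k]
    · rcases lt_or_gt_of_ne hm with h' | h'
      · left
        linarith [ha k, hb m, ha n, hb n, hN k, hN m, hxlt h', hx0 m, hx0 n, hx0 k]
      · right
        linarith [ha k, hb m, ha n, hb n, hN k, hN m, hxlt h, hxlt h', hx0 m, hx0 n, hx0 k]

/-- Two arcs of the families with centers `a`, `b` that meet after the rotation by `a n - b n` include
an `n`-th one. -/
theorem eq_or_eq_of_mem_arcs {a b μ : ℕ → ℝ}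
    (ha : ∀ n, 1 / 4 ≤ a n - μ n / 2 ∧ a n + μ n / 2 ≤ 3 / 4)
    (hb : ∀ n, 1 / 4 ≤ b n - μ n / 2 ∧ b n + μ n / 2 ≤ 3 / 4) (hμ : ∀ n, 0 < μ n)
    (hab : ∀ n k m, k ≠ n → m ≠ n → (μ k + μ m) / 2 ≤ |(a k - b m) - (a n - b n)|)
    {n k m : ℕ} {p q : UnitAddCircle} (hpq : p - q = ((a n - b n : ℝ) : UnitAddCircle))
    {y z : ℝ} (hy : y ∈ Set.Ioo (1 / 7 : ℝ) (6 / 7)) (hz : z ∈ Set.Ioo (1 / 7 : ℝ) (6 / 7))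
    (hp : p = ((a k + μ k * (y - 1 / 2) : ℝ) : UnitAddCircle))
    (hq : q = ((b m + μ m * (z - 1 / 2) : ℝ) : UnitAddCircle)) :
    k = n ∨ m = n := by
  obtain ⟨u, hu, rfl⟩ : ∃ u ∈ Set.Ioo (a k - μ k / 2) (a k + μ k / 2), p = (u : UnitAddCircle) :=
    ⟨_, mem_Ioo_of_rescale (hμ k) hy, hp⟩
  obtain ⟨v, hv, rfl⟩ : ∃ v ∈ Set.Ioo (b m - μ m / 2) (b m + μ m / 2), q = (v : UnitAddCircle) :=
    ⟨_, mem_Ioo_of_rescale (hμ m) hz, hq⟩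
  by_contra! h
  rw [← AddCircle.coe_sub] at hpq
  -- All the points lie in `[1/4, 3/4]`, so both differences are below `1/2` in absolute value and
  -- the congruence modulo `1` is an equality of reals.
  have e := UnitAddCircle.eq_of_coe_eq hpq (by
    rw [abs_lt]
    constructor <;> linarith [hu.1, hu.2, hv.1, hv.2, ha n, hb n, ha k, hb m, hμ n])
  have h1 := hab n k m h.1 h.2
  rw [← e] at h1
  have h2 : |a k - b m - (u - v)| < (μ k + μ m) / 2 := by
    rw [abs_lt]
    constructor <;> linarith [hu.1, hu.2, hv.1, hv.2]
  linarith

/-- A displaced point of the conjugate by `h` of an assembled diffeomorphism that lies outside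
`(1/7, 6/7)` is mapped by `h` to one of the other arcs. -/
theorem exists_ne_arc_of_conj_apply_ne {F : Equiv.Perm UnitAddCircle} {c μ : ℕ → ℝ}
    (hF : ∀ x : UnitAddCircle, F x ≠ x → ∃ n, ∃ z ∈ Set.Ioo (1 / 7 : ℝ) (6 / 7),
      x = ((c n + μ n * (z - 1 / 2) : ℝ) : UnitAddCircle))
    {h : Equiv.Perm UnitAddCircle} {n : ℕ} (hh : ∀ z ∈ Set.Ioo (1 / 7 : ℝ) (6 / 7),
      h (z : UnitAddCircle) = ((c n + μ n * (z - 1 / 2) : ℝ) : UnitAddCircle))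
    {x : UnitAddCircle} (hx : x ∉ ((↑) : ℝ → UnitAddCircle) '' Set.Ioo (1 / 7 : ℝ) (6 / 7))
    (hne : (h⁻¹ * F * h) x ≠ x) :
    ∃ k ≠ n, ∃ z ∈ Set.Ioo (1 / 7 : ℝ) (6 / 7),
      h x = ((c k + μ k * (z - 1 / 2) : ℝ) : UnitAddCircle) := by
  obtain ⟨k, z, hz, e⟩ := hF (h x) fun e => hne (by
    rw [Equiv.Perm.mul_apply, Equiv.Perm.mul_apply, e, Equiv.Perm.inv_eq_iff_eq])
  refine ⟨k, ?_, z, hz, e⟩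
  rintro rfl
  rw [← hh z hz] at e
  exact hx ⟨z, hz, (h.injective e).symm⟩

/-! ### Assembly of the proof. -/

theorem mainTheorem4
    (d : MetricSpace CircleDiff)
    (hd : d.toUniformSpace.toTopologicalSpace = CircleDiff.smoothTopology)
    (F₁ F₂ F₃ : CircleDiff) (hF₁ : F₁.IsRepellerAttractor) (hF₂ : F₂.IsBump)
    (hF₃ : F₃.IsIrrationalRotation) :
    ∃ (ε : ℕ → ℝ) (k : ℕ → ℕ), (∀ n, 0 < ε n) ∧ (∀ n, 0 < k n) ∧
      ∀ f g : ℕ → CircleDiff,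
        (∀ n, (f n).SupportedOn (1 / 7) (6 / 7)) →
        (∀ n, (g n).SupportedOn (1 / 7) (6 / 7)) →
        (∀ n, d.dist (f n) 1 < ε n) →
        (∀ n, d.dist (g n) 1 < ε n) →
        ∃ F₄ F₅ : CircleDiff, ∀ n,
          f n * g n * (f n)⁻¹ * (g n)⁻¹ ∈ Subgroup.closure ({F₁, F₂, F₃, F₄, F₅} : Set CircleDiff) ∧
          wordDist {F₁, F₂, F₃, F₄, F₅} (f n * g n * (f n)⁻¹ * (g n)⁻¹) 1 ≤ (k n : ℕ∞) := by
  obtain ⟨t, ht1, ht⟩ := hF₁.repelling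
  obtain ⟨α, hα, hrot⟩ := hF₃
  have ht0 : 0 < t⁻¹ := by positivity
  have hti : t⁻¹ < 1 := inv_lt_one_of_one_lt₀ ht1
  obtain ⟨i, j, N, a, b, hai, hbj, ha, hb, hadisj, hbdisj, hab⟩ := exists_arcs hα ht0 hti
  let μ : ℕ → ℝ := fun n => t⁻¹ ^ N n
  have hμ : ∀ n, 0 < μ n := fun n => pow_pos ht0 _
  have hμ1 : ∀ n, μ n ≤ 1 := fun n => pow_le_one₀ ht0.le hti.le
  -- In this bound `μ n ^ n` compensates the rescaling and `1/4 * (1/2) ^ n` makes the displacements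
  -- summable.
  choose ε hε hεd using fun n => exists_dist_lt_imp_abs_iteratedDeriv_lift_sub_le d hd n
    (δ := μ n ^ n * (1 / 4 * (1 / 2) ^ n)) (mul_pos (pow_pos (hμ n) n) (by positivity))
  let La : ℕ → ℕ := fun n => (i n).natAbs + N n
  let Lb : ℕ → ℕ := fun n => (j n).natAbs + N n
  let A : ℕ → ℕ := fun n => La n + 1 + La n
  let B : ℕ → ℕ := fun n => Lb n + 1 + Lb n
  refine ⟨ε, fun n => A n + B n + A n + B n, hε, fun n => by simp only [A]; omega, ?_⟩
  intro f g hf hg hfε hgε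
  obtain ⟨F₄, hF₄, hF₄'⟩ := exists_circleDiff_conj_on_arcs hμ hμ1 ha hadisj hf
    fun n => hεd n (f n) (hfε n)
  obtain ⟨F₅, hF₅, hF₅'⟩ := exists_circleDiff_conj_on_arcs hμ hμ1 hb hbdisj hg
    fun n => hεd n (g n) (hgε n)
  refine ⟨F₄, F₅, fun n => ?_⟩
  have hconj : ∀ (c : ℝ) (m : ℤ),
      (c : UnitAddCircle) = ((1 / 2 : ℝ) : UnitAddCircle) + ((m * α : ℝ) : UnitAddCircle) →
      ∀ z ∈ Set.Ioo (1 / 7 : ℝ) (6 / 7),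
        ((F₃ ^ m * F₁⁻¹ ^ N n : CircleDiff) : Equiv.Perm UnitAddCircle) (z : UnitAddCircle) =
          ((c + μ n * (z - 1 / 2) : ℝ) : UnitAddCircle) := by
    intro c m hc z hz
    rw [Subgroup.coe_mul, Equiv.Perm.mul_apply,
      CircleDiff.inv_pow_apply_coe ht1 ht (N n) ⟨by linarith [hz.1], by linarith [hz.2]⟩,
      CircleDiff.zpow_apply_of_rotation hrot, AddCircle.coe_add, AddCircle.coe_add, hc]
    abel
  let p : CircleDiff := F₃ ^ i n * F₁⁻¹ ^ N n
  let q : CircleDiff := F₃ ^ j n * F₁⁻¹ ^ N n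
  have hp := hconj (a n) (i n) (hai n)
  have hq := hconj (b n) (j n) (hbj n)
  -- Both words use the same power of `F₁⁻¹`, so they differ by a rotation on the whole circle, not
  -- only on the affine arc.
  have hpq : ∀ x, (p : Equiv.Perm UnitAddCircle) x - (q : Equiv.Perm UnitAddCircle) x =
      ((a n - b n : ℝ) : UnitAddCircle) := by
    intro x
    simp only [p, q, Subgroup.coe_mul, Equiv.Perm.mul_apply]
    rw [CircleDiff.zpow_apply_of_rotation hrot, CircleDiff.zpow_apply_of_rotation hrot,
      AddCircle.coe_sub, hai, hbj]
    abel
  have key : f n * g n * (f n)⁻¹ * (g n)⁻¹ =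
      (p⁻¹ * F₄ * p) * (q⁻¹ * F₅ * q) * (p⁻¹ * F₄ * p)⁻¹ * (q⁻¹ * F₅ * q)⁻¹ := by
    refine Subtype.ext (commutator_eq_of_eqOn
      (A := (p⁻¹ * F₄ * p : CircleDiff)) (B := (q⁻¹ * F₅ * q : CircleDiff))
      (U := ((↑) : ℝ → UnitAddCircle) '' Set.Ioo (1 / 7) (6 / 7)) (f := f n) (g := g n)
      (hf n) (hg n) ?_ ?_ ?_).symm
    · rintro _ ⟨z, hz, rfl⟩
      simp only [Subgroup.coe_mul, Subgroup.coe_inv, Equiv.Perm.mul_apply,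
        Equiv.Perm.inv_eq_iff_eq]
      exact hF₄ n p hp z hz
    · rintro _ ⟨z, hz, rfl⟩
      simp only [Subgroup.coe_mul, Subgroup.coe_inv, Equiv.Perm.mul_apply,
        Equiv.Perm.inv_eq_iff_eq]
      exact hF₅ n q hq z hz
    -- A point outside `U` moved by both conjugates would give two arcs with indices `k, m ≠ n` that
    -- meet after the rotation.
    · intro x hx
      by_contra! h
      obtain ⟨k, hk, y, hy, hpx⟩ := exists_ne_arc_of_conj_apply_ne hF₄' hp hx h.1
      obtain ⟨m, hm, z, hz, hqx⟩ := exists_ne_arc_of_conj_apply_ne hF₅' hq hx h.2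
      exact (eq_or_eq_of_mem_arcs ha hb hμ hab (hpq x) hy hz hpx hqx).elim hk hm
  have h₁ : IsWordOfLengthLE {F₁, F₂, F₃, F₄, F₅} F₁ 1 := .of_mem (by simp)
  have h₃ : IsWordOfLengthLE {F₁, F₂, F₃, F₄, F₅} F₃ 1 := .of_mem (by simp)
  have h₄ : IsWordOfLengthLE {F₁, F₂, F₃, F₄, F₅} F₄ 1 := .of_mem (by simp)
  have h₅ : IsWordOfLengthLE {F₁, F₂, F₃, F₄, F₅} F₅ 1 := .of_mem (by simp)
  have wp : IsWordOfLengthLE {F₁, F₂, F₃, F₄, F₅} p (La n) := (h₃.zpow _).mul (h₁.inv.pow _)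
  have wq : IsWordOfLengthLE {F₁, F₂, F₃, F₄, F₅} q (Lb n) := (h₃.zpow _).mul (h₁.inv.pow _)
  have wA : IsWordOfLengthLE {F₁, F₂, F₃, F₄, F₅} (p⁻¹ * F₄ * p) (A n) := (wp.inv.mul h₄).mul wp
  have wB : IsWordOfLengthLE {F₁, F₂, F₃, F₄, F₅} (q⁻¹ * F₅ * q) (B n) := (wq.inv.mul h₅).mul wq
  rw [key]
  have w := ((wA.mul wB).mul wA.inv).mul wB.inv
  exact ⟨w.mem_closure, w.wordDist_le⟩
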